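/- Let $D$ be an integral domain with quotient field $K$. An overring of $D$ is a ring $T$ with $D\subseteq T\subseteq K$. A semistar operation on $D$ is a map $I\mapsto I^\star$ on the set of $D$-submodules of $K$ such that, for all $D$-submodules $I,J$ of $K$ and all $x\in K$: $I\subseteq I^\star$; $I\subseteq J$ implies $I^\star\subseteq J^\star$; $(I^\star)^\star=I^\star$; $x\cdot I^\star=(xI)^\star$. It is stable if $(I\cap J)^\star=I^\star\cap J^\star$ for all $I,J$. Let $\mathrm{Stab}(D)$ be the set of stable semistar operations on $D$, ordered by $\star_1\le\star_2$ iff $I^{\star_1}\subseteq I^{\star_2}$ for all $I$. For an overring $T$ of $D$, the restriction $\star|_T$ of $\star\in\mathrm{Stab}(D)$ to the $T$-submodules of $K$ is an element of $\mathrm{Stab}(T)$. A Jaffard family of $D$ is a set $\Theta$ of overrings of $D$, all flat over $D$, such that: either $K\notin\Theta$ or $\Theta=\{K\}$; $I=\bigcap_{T\in\Theta}IT$ for every ideal $I$ of $D$; for distinct $A,B\in\Theta$ the only prime of $D$ that is contracted both from a prime of $A$ and from a prime of $B$ is $(0)$; and every nonzero $x\in K$ is a nonunit in only finitely many members of $\Theta$.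 A Jaffard overring of $D$ is a member of a Jaffard family of $D$. For a set $\Theta$ of overrings of $D$, define by transfinite recursion $\Theta_0=\Theta$, $T_\alpha=\bigcap_{S\in\Theta_\alpha}S$ (with $T_\alpha=K$ if $\Theta_\alpha=\emptyset$), $\Theta_{\alpha+1}=\{S\in\Theta_\alpha\mid S\text{ is not a Jaffard overring of }T_\alpha\}$, and $\Theta_\alpha=\bigcap_{\beta<\alpha}\Theta_\beta$ for a limit ordinal $\alpha$. The family $\Theta$ is sharp if $T_\alpha=K$, where $\alpha$ is the least ordinal with $T_{\alpha'}=T_\alpha$ for all $\alpha'>\alpha$. A one-dimensional domain $D$ is ultimately sharp if $\{D_M\mid M\in\mathrm{Max}(D)\}$ is sharp. The domain $D$ is almost Dedekind if $D_M$ is a discrete valuation ring (not a field) for every $M\in\mathrm{Max}(D)$. **Corollary.** Let $D$ be an almost Dedekind domain that is ultimately sharp. Then: 1. the map $\star\mapsto(\star|_{D_M})_{M}$ is an order isomorphism $\mathrm{Stab}(D)\to\prod_{M\in\mathrm{Max}(D)}\mathrm{Stab}(D_M)$, whose inverse sends $(\star^{(M)})_M$ to the operation $I\mapsto\bigcap_{M}(ID_M)^{\star^{(M)}}$;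 2. for every $M\in\mathrm{Max}(D)$, the set $\mathrm{Stab}(D_M)$ has exactly two elements: the identity, and the operation sending every nonzero submodule to $K$; 3. the map $\star\mapsto\{M\in\mathrm{Max}(D)\mid \star|_{D_M}\text{ is the identity}\}$ is a bijection from $\mathrm{Stab}(D)$ onto the power set of $\mathrm{Max}(D)$; its inverse sends $S\subseteq\mathrm{Max}(D)$ to the operation with $I\mapsto\bigcap_{M\in S}ID_M$ for all $I\neq(0)$ (so $I\mapsto K$ if $S=\emptyset$). -/

import Mathlib

open scoped Pointwise

universe u v

noncomputable section

/-- A domain all of whose localizations at maximal ideals are discrete valuation rings.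
A field is not almost Dedekind in this sense (almost Dedekind domains are one-dimensional). -/
def IsAlmostDedekind (D : Type v) [CommRing D] [IsDomain D] : Prop :=
  ∀ M : MaximalSpectrum D, IsDiscreteValuationRing (Localization.AtPrime M.asIdeal)

section Overrings

/-! Overrings of `D` are the `D`-subalgebras of its quotient field `K`. -/

variable {D : Type v} {K : Type u} [CommRing D] [Field K] [Algebra D K]

/-- The product `IT`, i.e. the `T`-submodule of `K` generated by `I`. -/
def extendTo (I : Submodule D K) (T : Subalgebra D K) : Submodule T K :=
  Submodule.span T (I : Set K)

/-- `σ(T)`: the contractions to `D` of the prime ideals of `T`. -/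
def sigmaSet (T : Subalgebra D K) : Set (PrimeSpectrum D) :=
  Set.range (PrimeSpectrum.comap (algebraMap D T))

/-- `I = ⋂ IT` for every ideal `I` of `D`, the ideals being viewed inside `K`. -/
def IsCompleteFamily (Θ : Set (Subalgebra D K)) : Prop :=
  ∀ I : Ideal D, Submodule.map (Algebra.linearMap D K) I =
    ⨅ T ∈ Θ, (extendTo (Submodule.map (Algebra.linearMap D K) I) T).restrictScalars D

/-- Distinct members have only the zero prime in common. -/
def IsIndependentFamily (Θ : Set (Subalgebra D K)) : Prop :=
  ∀ A ∈ Θ, ∀ B ∈ Θ, A ≠ B → sigmaSet A ∩ sigmaSet B = {P | P.asIdeal = ⊥}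

/-- Every nonzero `x` in `K` is a unit in all but finitely many members. -/
def IsLocallyFiniteFamily (Θ : Set (Subalgebra D K)) : Prop :=
  ∀ x : K, x ≠ 0 → {T ∈ Θ | ¬ (x ∈ T ∧ x⁻¹ ∈ T)}.Finite

/-- Jaffard families of overrings of `D`. -/
structure IsJaffardFamily (Θ : Set (Subalgebra D K)) : Prop where
  top_notMem_or : ⊤ ∉ Θ ∨ Θ = {⊤}
  flat : ∀ T ∈ Θ, Module.Flat D T
  complete : IsCompleteFamily Θ
  independent : IsIndependentFamily Θ
  locallyFinite : IsLocallyFiniteFamily Θ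

/-- An overring of `D` is a Jaffard overring if it belongs to a Jaffard family of `D`. -/
def IsJaffardOverring (T : Subalgebra D K) : Prop :=
  ∃ Θ : Set (Subalgebra D K), IsJaffardFamily Θ ∧ T ∈ Θ

/-- `S` contains the overring `T` of `D`, and is a Jaffard overring of the domain `T`. -/
def IsJaffardOverringOf (T S : Subalgebra D K) : Prop :=
  ∃ S' : Subalgebra T K, S'.restrictScalars D = S ∧ IsJaffardOverring S'

/-- `Θ_α`: at a successor step the members that are Jaffard overrings of
`T_γ = ⋂ Θ_γ` are removed, and at a limit step the intersection is taken. -/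
def derivedFamily (Θ : Set (Subalgebra D K)) (α : Ordinal.{u}) : Set (Subalgebra D K) :=
  Ordinal.limitRecOn (motive := fun _ => Set (Subalgebra D K)) α
    Θ
    (fun _ Θγ => {S ∈ Θγ | ¬ IsJaffardOverringOf (sInf Θγ) S})
    (fun α _ ih => {S | ∀ (β : Ordinal.{u}) (h : β < α), S ∈ ih β h})

/-- The derived sequence `T_α = ⋂ Θ_α`; it is `⊤ = K` if `Θ_α` is empty. -/
def derivedRing (Θ : Set (Subalgebra D K)) (α : Ordinal.{u}) : Subalgebra D K :=
  sInf (derivedFamily Θ α)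

/-- The least ordinal from which on the derived sequence is constant. -/
def jaffardDegree (Θ : Set (Subalgebra D K)) : Ordinal.{u} :=
  sInf {α | ∀ α' > α, derivedRing Θ α' = derivedRing Θ α}

/-- The stable value of the derived sequence. -/
def dullLimit (Θ : Set (Subalgebra D K)) : Subalgebra D K :=
  derivedRing Θ (jaffardDegree Θ)

/-- A family is sharp if its dull limit is `K`. -/
def IsSharpFamily (Θ : Set (Subalgebra D K)) : Prop :=
  dullLimit Θ = ⊤

end Overrings

section Localizations

variable {D : Type v} (K : Type u) [CommRing D] [IsDomain D] [Field K] [Algebra D K]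
  [IsFractionRing D K]

/-- The localization `D_M` as an overring of `D`. -/
abbrev locAt (M : MaximalSpectrum D) : Subalgebra D K :=
  Localization.subalgebra.ofField K M.asIdeal.primeCompl
    M.asIdeal.primeCompl_le_nonZeroDivisors

variable (D) in
/-- The one-dimensional domain `D` is ultimately sharp if `{D_M | M ∈ Max(D)}` is sharp. -/
def IsUltimatelySharp : Prop :=
  IsSharpFamily (Set.range (locAt K : MaximalSpectrum D → Subalgebra D K))

end Localizations

section Semistar

/-- Semistar operations on `D`: closure operations on the `D`-submodules of `K` that
commute with multiplication by elements of `K`. -/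
@[ext]
structure SemistarOperation (D : Type v) (K : Type u) [CommRing D] [Field K] [Algebra D K] where
  toFun : Submodule D K → Submodule D K
  le_toFun : ∀ I, I ≤ toFun I
  mono : ∀ I J, I ≤ J → toFun I ≤ toFun J
  idem : ∀ I, toFun (toFun I) = toFun I
  smul : ∀ (x : K) (I), x • toFun I = toFun (x • I)

variable {D : Type v} {K : Type u} [CommRing D] [Field K] [Algebra D K]

/-- A semistar operation is stable if it commutes with binary intersections. -/
def SemistarOperation.IsStable (s : SemistarOperation D K) : Prop :=
  ∀ I J, s.toFun (I ⊓ J) = s.toFun I ⊓ s.toFun J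

instance : PartialOrder (SemistarOperation D K) where
  le s t := ∀ I, s.toFun I ≤ t.toFun I
  le_refl _ _ := le_rfl
  le_trans _ _ _ h h' I := (h I).trans (h' I)
  le_antisymm _ _ h h' := SemistarOperation.ext (funext fun I => le_antisymm (h I) (h' I))

variable (D K) in
/-- The ordered set of stable semistar operations on `D`. -/
abbrev StableSemistar : Type u :=
  {s : SemistarOperation D K // s.IsStable}

/-- The restriction of a semistar operation to the `T`-submodules of `K`. -/
def SemistarOperation.restrict (s : SemistarOperation D K) (T : Subalgebra D K) :
    SemistarOperation T K where
  toFun I :=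
    { (s.toFun (I.restrictScalars D)).toAddSubmonoid with
      smul_mem' := by
        intro c x hx
        have h : (c : K) • I.restrictScalars D ≤ I.restrictScalars D := by
          rintro _ ⟨y, hy, rfl⟩
          exact I.smul_mem c hy
        have h2 : (c : K) * x ∈ (c : K) • s.toFun (I.restrictScalars D) :=
          Submodule.smul_mem_pointwise_smul x (c : K) _ hx
        rw [s.smul] at h2
        exact s.mono _ _ h h2 }
  le_toFun I x hx := s.le_toFun (I.restrictScalars D) hx
  mono I J h x hx := s.mono (I.restrictScalars D) (J.restrictScalars D) h hx
  idem I := by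
    ext x
    exact SetLike.ext_iff.1 (s.idem (I.restrictScalars D)) x
  smul x I := by
    ext y
    exact SetLike.ext_iff.1 (s.smul x (I.restrictScalars D)) y

/-- The restriction of a stable semistar operation to an overring, as a stable operation. -/
def StableSemistar.restrict (s : StableSemistar D K) (T : Subalgebra D K) :
    StableSemistar T K :=
  ⟨s.1.restrict T, fun I J => by
    ext x
    exact SetLike.ext_iff.1 (s.2 (I.restrictScalars D) (J.restrictScalars D)) x⟩

end Semistar

end

/-! ### Pointwise multiples and extension of submodules to an overring. -/

section Generalities

variable {D : Type v} {K : Type u} [CommRing D] [Field K] [Algebra D K]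

/-! Everything rests on `SemistarOperation.IsStable.toFun_eq_iInf`: for stable `s`, the closure
`s(I)` is the intersection of the `s(I D_M)`. Hence restriction to the `D_M` is injective and
reflects the order. Gluing is a right inverse because a nonzero `D_N`-module extended to `D_M` with
`M ≠ N` is all of `K`. A discrete valuation ring has only two stable operations, which turns the
product into a power set.

For the identity, stability converts `x ∈ s(I)` into `1 ∈ s(J)` with `J = x⁻¹I ∩ D`, and it is
enough that `s(J)` contains, for each `M`, an element of `D` outside `M`. This is proved by
transfinite induction on the stage at which `D_M` leaves the derived family
(`SemistarOperation.IsStable.exists_notMem_algebraMap_mem`); sharpness says that every `D_M` leaves.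
A removed `D_M` is a Jaffard overring of `T_α`, which isolates `M`
(`IsJaffardOverringOf.exists_notMem_dvd`): for `0 ≠ x ∈ J ∩ D` some `b ∉ M` lies in `x D_N` for
every other surviving `N`. Then `Q = (J : b)` generates `D_N` at those `N`, and the induction
hypothesis covers the `N` already gone. So `Q D_M ∩ D ⊆ s(Q)`, whence `1 ∈ s(Q)`, that is, `b ∈
s(J)`. -/

theorem algebraMap_ne_zero_of_notMem [FaithfulSMul D K] {M : MaximalSpectrum D} {c : D} (hc : c ∉ M.asIdeal) :
    algebraMap D K c ≠ 0 := fun h => by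
  rw [FaithfulSMul.algebraMap_eq_zero_iff] at h
  exact hc (h ▸ M.asIdeal.zero_mem)

theorem exists_mem_notMem_of_ne {M N : MaximalSpectrum D} (h : M ≠ N) :
    ∃ c ∈ N.asIdeal, c ∉ M.asIdeal := by
  by_contra! hc
  exact h (MaximalSpectrum.ext (N.isMaximal.eq_of_le M.isMaximal.ne_top hc).symm)

theorem mem_pointwise_smul_iff {R : Type*} [CommRing R] [Algebra R K] {x : K} (hx : x ≠ 0)
    {I : Submodule R K} {z : K} : z ∈ x • I ↔ x⁻¹ * z ∈ I := by
  constructor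
  · rintro ⟨y, hy, rfl⟩
    simpa [hx] using hy
  · intro h
    exact ⟨_, h, by simp [hx]⟩

theorem zero_pointwise_smul {R : Type*} [CommRing R] [Algebra R K] (I : Submodule R K) :
    (0 : K) • I = ⊥ := by
  rw [eq_bot_iff]
  rintro _ ⟨y, -, rfl⟩
  simp

theorem extendTo_bot (T : Subalgebra D K) : extendTo (⊥ : Submodule D K) T = ⊥ := by
  rw [extendTo, Submodule.span_eq_bot]
  simp

theorem le_extendTo (I : Submodule D K) (T : Subalgebra D K) :
    I ≤ (extendTo I T).restrictScalars D :=
  fun _ h => Submodule.subset_span h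

theorem extendTo_mono {I J : Submodule D K} (h : I ≤ J) (T : Subalgebra D K) :
    extendTo I T ≤ extendTo J T :=
  Submodule.span_mono h

theorem extendTo_restrictScalars (T : Subalgebra D K) (I : Submodule T K) :
    extendTo (I.restrictScalars D) T = I :=
  Submodule.span_eq I

end Generalities

/-! ### The localizations `D_M` inside `K`, and their valuation theory. -/

section LocalizationsAtMaximalIdeals

variable {D : Type v} {K : Type u} [CommRing D] [IsDomain D] [Field K] [Algebra D K]
  [IsFractionRing D K]

theorem mem_locAt_iff {M : MaximalSpectrum D} {z : K} :
    z ∈ locAt K M ↔ ∃ c ∉ M.asIdeal, ∃ a, c • z = algebraMap D K a := by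
  constructor
  · rintro ⟨a, c, hc, rfl⟩
    refine ⟨c, hc, a, ?_⟩
    rw [Algebra.smul_def, mul_left_comm, mul_inv_cancel₀ (algebraMap_ne_zero_of_notMem hc), mul_one]
  · rintro ⟨c, hc, a, h⟩
    refine ⟨a, c, hc, ?_⟩
    rw [← h, Algebra.smul_def, mul_comm, inv_mul_cancel_left₀ (algebraMap_ne_zero_of_notMem hc)]

theorem inv_algebraMap_mem_locAt {M : MaximalSpectrum D} {c : D} (hc : c ∉ M.asIdeal) :
    (algebraMap D K c)⁻¹ ∈ locAt K M :=
  mem_locAt_iff.2 ⟨c, hc, 1, by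
    rw [Algebra.smul_def, mul_inv_cancel₀ (algebraMap_ne_zero_of_notMem hc), map_one]⟩

theorem inv_algebraMap_notMem_locAt {M : MaximalSpectrum D} {c : D} (hc : c ∈ M.asIdeal)
    (h0 : c ≠ 0) : (algebraMap D K c)⁻¹ ∉ locAt K M := by
  intro h
  obtain ⟨d, hd, a, h⟩ := mem_locAt_iff.1 h
  have hc0 : algebraMap D K c ≠ 0 := by rwa [Ne, FaithfulSMul.algebraMap_eq_zero_iff]
  rw [Algebra.smul_def, mul_inv_eq_iff_eq_mul₀ hc0, ← map_mul] at h
  rw [FaithfulSMul.algebraMap_injective D K h] at hd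
  exact hd (M.asIdeal.mul_mem_left _ hc)

theorem eq_of_locAt_le {M N : MaximalSpectrum D} (h : locAt K M ≤ locAt K N) : M = N := by
  by_contra hne
  obtain ⟨c, hcN, hcM⟩ := exists_mem_notMem_of_ne hne
  exact inv_algebraMap_notMem_locAt hcN (by rintro rfl; exact hcM M.asIdeal.zero_mem)
    (h (inv_algebraMap_mem_locAt hcM))

theorem mem_extendTo_locAt {I : Submodule D K} {M : MaximalSpectrum D} {z : K} :
    z ∈ extendTo I (locAt K M) ↔ ∃ c ∉ M.asIdeal, c • z ∈ I := by
  constructor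
  · intro h
    induction h using Submodule.span_induction with
    | mem x hx => exact ⟨1, M.isMaximal.isPrime.one_notMem, by rwa [one_smul]⟩
    | zero => exact ⟨1, M.isMaximal.isPrime.one_notMem, by rw [smul_zero]; exact I.zero_mem⟩
    | add x y _ _ hx hy =>
      obtain ⟨c, hc, hx⟩ := hx
      obtain ⟨d, hd, hy⟩ := hy
      refine ⟨c * d, fun h => (M.isMaximal.isPrime.mem_or_mem h).elim hc hd, ?_⟩
      rw [smul_add]
      refine I.add_mem ?_ ?_
      · rw [mul_comm, mul_smul]; exact I.smul_mem _ hx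
      · rw [mul_smul]; exact I.smul_mem _ hy
    | smul a x _ hx =>
      obtain ⟨c, hc, hx⟩ := hx
      obtain ⟨d, hd, b, hb⟩ := mem_locAt_iff.1 a.2
      refine ⟨d * c, fun h => (M.isMaximal.isPrime.mem_or_mem h).elim hd hc, ?_⟩
      have : (d * c) • a • x = b • c • x := by
        rw [Algebra.smul_def b, ← hb, mul_smul, Subalgebra.smul_def, smul_eq_mul]
        simp only [Algebra.smul_def]
        ring
      rw [this]
      exact I.smul_mem _ hx
  · rintro ⟨c, hc, h⟩
    have : z = (⟨_, inv_algebraMap_mem_locAt hc⟩ : locAt K M) • c • z := by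
      rw [Subalgebra.smul_def, Algebra.smul_def c, smul_eq_mul,
        inv_mul_cancel_left₀ (algebraMap_ne_zero_of_notMem hc)]
    rw [this]
    exact Submodule.smul_mem _ _ (Submodule.subset_span h)

/-- Two denominators outside `M` have their product as a common one. This is what makes glued
operations stable. -/
theorem extendTo_locAt_inf (I J : Submodule D K) (M : MaximalSpectrum D) :
    extendTo (I ⊓ J) (locAt K M) = extendTo I (locAt K M) ⊓ extendTo J (locAt K M) := by
  ext z
  simp only [Submodule.mem_inf, mem_extendTo_locAt]
  constructor
  · rintro ⟨c, hc, h⟩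
    exact ⟨⟨c, hc, h.1⟩, ⟨c, hc, h.2⟩⟩
  · rintro ⟨⟨c, hc, h⟩, ⟨d, hd, h'⟩⟩
    refine ⟨c * d, fun h => (M.isMaximal.isPrime.mem_or_mem h).elim hc hd, ?_, ?_⟩
    · rw [mul_comm, mul_smul]; exact I.smul_mem _ h
    · rw [mul_smul]; exact J.smul_mem _ h'

theorem extendTo_locAt_smul {x : K} (hx : x ≠ 0) (I : Submodule D K) (M : MaximalSpectrum D) :
    extendTo (x • I) (locAt K M) = x • extendTo I (locAt K M) := by
  ext z
  simp only [mem_pointwise_smul_iff hx, mem_extendTo_locAt, mul_smul_comm]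

theorem isDiscreteValuationRing_locAt (hD : IsAlmostDedekind D) (M : MaximalSpectrum D) :
    IsDiscreteValuationRing (locAt K M) := by
  have := hD M
  exact IsDiscreteValuationRing.RingEquivClass.isDiscreteValuationRing
    (IsLocalization.algEquiv M.asIdeal.primeCompl (Localization.AtPrime M.asIdeal) (locAt K M))

theorem inv_mem_locAt_of_notMem (hD : IsAlmostDedekind D) {M : MaximalSpectrum D} {z : K}
    (hz : z ∉ locAt K M) : z⁻¹ ∈ locAt K M := by
  have := isDiscreteValuationRing_locAt (K := K) hD M
  rcases ValuationRing.isInteger_or_isInteger (locAt K M) z with ⟨a, h⟩ | ⟨a, h⟩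
  · exact absurd (h ▸ a.2) hz
  · exact h ▸ a.2

/-- The value group has rank one: `m` is a nonunit of `D_M`, so its powers absorb any denominator.
-/
theorem exists_mul_pow_mem_locAt (hD : IsAlmostDedekind D) {M : MaximalSpectrum D} {m : K}
    (hm : m ∈ locAt K M) (hm' : m⁻¹ ∉ locAt K M) (w : K) :
    ∃ n : ℕ, w * m ^ n ∈ locAt K M := by
  have := isDiscreteValuationRing_locAt (K := K) hD M
  obtain ⟨ϖ, hϖ⟩ := IsDiscreteValuationRing.exists_irreducible (locAt K M)
  have hdvd : ϖ ∣ ⟨m, hm⟩ := by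
    rw [← Ideal.mem_span_singleton, ← hϖ.maximalIdeal_eq, IsLocalRing.mem_maximalIdeal,
      mem_nonunits_iff]
    intro h
    obtain ⟨b, hb⟩ := h.exists_right_inv
    have hb' : m * (b : K) = 1 := congrArg Subtype.val hb
    exact hm' (eq_inv_of_mul_eq_one_right hb' ▸ b.2)
  obtain ⟨a, b, hb, rfl⟩ := IsFractionRing.div_surjective (locAt K M) w
  have hb0 : b ≠ 0 := nonZeroDivisors.ne_zero hb
  obtain ⟨n, hn⟩ := IsDiscreteValuationRing.associated_pow_irreducible hb0 hϖ
  obtain ⟨c, hc⟩ := hn.dvd.trans (pow_dvd_pow_of_dvd hdvd n)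
  refine ⟨n, ?_⟩
  have hc' : m ^ n = (b : K) * c := congrArg Subtype.val hc
  have hbK : (b : K) ≠ 0 := fun h => hb0 (Subtype.ext h)
  have : (algebraMap (locAt K M) K a / algebraMap (locAt K M) K b) * m ^ n = (a : K) * c := by
    rw [hc']
    change (a : K) / b * (b * c) = _
    field_simp
  rw [this]
  exact mul_mem a.2 c.2

/-- Multiplication by `z` lowers the valuation, so iterating it on a nonzero element of `I` reaches
arbitrarily negative values. -/
theorem eq_top_of_mul_mem (hD : IsAlmostDedekind D) {M : MaximalSpectrum D} {z : K}
    (hz : z ∉ locAt K M) {I : Submodule (locAt K M) K} (hI : I ≠ ⊥)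
    (h : ∀ y ∈ I, z * y ∈ I) : I = ⊤ := by
  rw [eq_top_iff]
  rintro w -
  obtain ⟨y, hy, hy0⟩ := I.exists_mem_ne_zero_of_ne_bot hI
  have hpow : ∀ n : ℕ, z ^ n * y ∈ I := by
    intro n
    induction n with
    | zero => simpa
    | succ n ih => rw [pow_succ', mul_assoc]; exact h _ ih
  have hz0 : z ≠ 0 := by rintro rfl; exact hz (zero_mem _)
  obtain ⟨n, hn⟩ := exists_mul_pow_mem_locAt hD (inv_mem_locAt_of_notMem hD hz)
    (by rwa [inv_inv]) (w * y⁻¹)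
  have := I.smul_mem ⟨_, hn⟩ (hpow n)
  rw [Subalgebra.smul_def, smul_eq_mul] at this
  convert this using 1
  change w = w * y⁻¹ * z⁻¹ ^ n * (z ^ n * y)
  rw [inv_pow]
  field_simp

/-- For `c` in `N` but not in `M`, the inverse of `c` acts on `I`, hence on `I D_N`, although it is
not in `D_N`. -/
theorem extendTo_locAt_eq_top (hD : IsAlmostDedekind D) {M N : MaximalSpectrum D} (h : M ≠ N)
    {I : Submodule (locAt K M) K} (hI : I ≠ ⊥) :
    extendTo (I.restrictScalars D) (locAt K N) = ⊤ := by
  obtain ⟨c, hcN, hcM⟩ := exists_mem_notMem_of_ne h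
  refine eq_top_of_mul_mem hD (inv_algebraMap_notMem_locAt (K := K) hcN
    (by rintro rfl; exact hcM M.asIdeal.zero_mem)) (fun hbot => hI ?_) fun y hy => ?_
  · rw [eq_bot_iff]
    exact fun y hy => (hbot ▸ le_extendTo (I.restrictScalars D) (locAt K N) hy :
      y ∈ (⊥ : Submodule (locAt K N) K))
  · obtain ⟨d, hd, hy⟩ := mem_extendTo_locAt.1 hy
    refine mem_extendTo_locAt.2 ⟨d, hd, ?_⟩
    rw [← mul_smul_comm]
    exact I.smul_mem ⟨_, inv_algebraMap_mem_locAt hcM⟩ hy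

end LocalizationsAtMaximalIdeals

/-! ### Jaffard overrings isolate maximal ideals. -/

section JaffardIsolation

variable {D : Type v} {K : Type u} [CommRing D] [IsDomain D] [Field K] [Algebra D K]
  [IsFractionRing D K]

instance (M : MaximalSpectrum D) : IsLocalRing (locAt K M) :=
  IsLocalization.AtPrime.isLocalRing (locAt K M) M.asIdeal

/-- The center on `R` of the local ring `D_M`, where the image of `R` in `K` lies in `D_M`. -/
noncomputable def localCenter {R : Type*} [CommRing R] [Algebra R K] (M : MaximalSpectrum D)
    (h : ∀ r, algebraMap R K r ∈ locAt K M) : Ideal R :=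
  (IsLocalRing.maximalIdeal (locAt K M)).comap ((algebraMap R K).codRestrict (locAt K M) h)

section localCenter

variable {R : Type*} [CommRing R] [Algebra R K] {M : MaximalSpectrum D}
  (h : ∀ r, algebraMap R K r ∈ locAt K M)

instance : (localCenter M h).IsPrime := Ideal.IsPrime.comap _

theorem inv_notMem_of_mem_localCenter {r : R} (hr : r ∈ localCenter M h)
    (h0 : algebraMap R K r ≠ 0) : (algebraMap R K r)⁻¹ ∉ locAt K M := by
  intro hinv
  have : IsUnit ((algebraMap R K).codRestrict (locAt K M) h r) :=
    IsUnit.of_mul_eq_one ⟨_, hinv⟩ (Subtype.ext (mul_inv_cancel₀ h0))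
  exact (IsLocalRing.mem_maximalIdeal _).1 hr this

theorem algebraMap_mem_localCenter_iff [Algebra D R] [IsScalarTower D R K] {d : D} :
    algebraMap D R d ∈ localCenter M h ↔ d ∈ M.asIdeal := by
  rw [← IsLocalization.AtPrime.to_map_mem_maximal_iff (locAt K M) M.asIdeal d, localCenter,
    Ideal.mem_comap]
  have : (algebraMap R K).codRestrict (locAt K M) h (algebraMap D R d) =
      algebraMap D (locAt K M) d :=
    Subtype.ext (IsScalarTower.algebraMap_apply D R K d).symm
  rw [this]

/-- Such an `r` is a unit of `D_M`, so its numerator also avoids `M`. -/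
theorem exists_notMem_smul_eq_of_notMem_localCenter {r : R} (hr : r ∉ localCenter M h) :
    ∃ c ∉ M.asIdeal, ∃ b ∉ M.asIdeal, c • algebraMap R K r = algebraMap D K b := by
  obtain ⟨c, hc, b, hb⟩ := mem_locAt_iff.1 (h r)
  refine ⟨c, hc, b, fun hbM => hr ?_, hb⟩
  rw [← IsLocalization.AtPrime.to_map_mem_maximal_iff (locAt K M) M.asIdeal b] at hbM
  have : algebraMap D (locAt K M) b =
      algebraMap D (locAt K M) c * (algebraMap R K).codRestrict (locAt K M) h r :=
    Subtype.ext (by rw [Algebra.smul_def] at hb; exact hb.symm)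
  rw [this] at hbM
  refine ((IsLocalRing.maximalIdeal.isMaximal _).isPrime.mem_or_mem hbM).resolve_left
    fun hcM => hc ?_
  rwa [IsLocalization.AtPrime.to_map_mem_maximal_iff (locAt K M) M.asIdeal c] at hcM

end localCenter

variable {T : Subalgebra D K} {M : MaximalSpectrum D}

/-- An overring of `T` in which the center of `D_M` does not survive contains, together with each
nonzero `x` of `D`, multiples of `x` that lie in `T` outside of that center. -/
theorem exists_notMem_localCenter_eq_mul (hD : IsAlmostDedekind D)
    (hT : ∀ t : T, algebraMap T K t ∈ locAt K M) {A : Subalgebra T K}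
    (hA : ∀ Q : PrimeSpectrum A, Q.asIdeal.comap (algebraMap T A) ≠ localCenter M hT)
    {x : D} (hx : x ≠ 0) :
    ∃ t ∉ localCenter M hT, ∃ a ∈ A, algebraMap T K t = algebraMap D K x * a := by
  by_contra! hcon
  have hxK : algebraMap D K x ≠ 0 := by rwa [Ne, FaithfulSMul.algebraMap_eq_zero_iff]
  set I : Ideal A := Ideal.span {algebraMap T A (algebraMap D T x)}
  have hxI : algebraMap D T x ∈ I.comap (algebraMap T A) := Ideal.subset_span rfl
  -- If the claim fails, then `xA ∩ T` lies in the center.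
  have hI : I.comap (algebraMap T A) ≤ localCenter M hT := by
    intro t ht
    by_contra htM
    obtain ⟨a, ha⟩ := Ideal.mem_span_singleton.1 (Ideal.mem_comap.1 ht)
    exact hcon t htM a a.2 (congrArg Subtype.val ha)
  -- Each nonzero `p` in the center has a power in `x D_M`, so a prime between `xA ∩ T` and the
  -- center contains `p`.
  have hmin : localCenter M hT ∈ (I.comap (algebraMap T A)).minimalPrimes := by
    refine ⟨⟨inferInstance, hI⟩, fun J ⟨hJ, hIJ⟩ hJM p hp => ?_⟩
    by_cases h0 : algebraMap T K p = 0
    · rw [FaithfulSMul.algebraMap_eq_zero_iff] at h0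
      exact h0 ▸ J.zero_mem
    obtain ⟨n, hn⟩ := exists_mul_pow_mem_locAt hD (hT p) (inv_notMem_of_mem_localCenter hT hp h0)
      (algebraMap D K x)⁻¹
    obtain ⟨c, hc, a, ha⟩ := mem_locAt_iff.1 hn
    have hcJ : algebraMap D T c ∉ J := fun h =>
      hc ((algebraMap_mem_localCenter_iff hT).1 (hJM h))
    have heq : algebraMap D T c * p ^ n = algebraMap D T a * algebraMap D T x := by
      apply FaithfulSMul.algebraMap_injective T K
      rw [map_mul, map_mul, map_pow, ← IsScalarTower.algebraMap_apply,
        ← IsScalarTower.algebraMap_apply, ← IsScalarTower.algebraMap_apply, ← ha,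
        Algebra.smul_def]
      field_simp
    have hmem : algebraMap D T c * p ^ n ∈ J := heq ▸ J.mul_mem_left _ (hIJ hxI)
    exact hJ.mem_of_pow_mem _ ((hJ.mem_or_mem hmem).resolve_left hcJ)
  -- A minimal prime over a contracted ideal is itself contracted, contrary to `hA`.
  obtain ⟨Q, hQ, -, hQM⟩ := Ideal.exists_comap_eq_of_mem_minimalPrimes (algebraMap T A) _ hmin
  exact hA ⟨Q, hQ⟩ hQM

/-- A complete family of overrings of `T ⊆ D_N` has a member contained in `D_N`. -/
theorem IsCompleteFamily.exists_le_locAt (hD : IsAlmostDedekind D)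
    {Θ : Set (Subalgebra T K)} (hΘ : IsCompleteFamily Θ) {N : MaximalSpectrum D}
    (hT : ∀ t : T, algebraMap T K t ∈ locAt K N) : ∃ A ∈ Θ, ∀ z ∈ A, z ∈ locAt K N := by
  have h1 : (1 : K) ∉ Submodule.map (Algebra.linearMap T K) (localCenter N hT) := by
    rintro ⟨t, ht, h⟩
    have : t = 1 := FaithfulSMul.algebraMap_injective T K (h.trans (map_one _).symm)
    exact (inferInstance : (localCenter N hT).IsPrime).one_notMem (this ▸ ht)
  -- Completeness at the center of `D_N` yields a member `A` in which the center generates a proper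
  -- ideal.
  rw [hΘ (localCenter N hT)] at h1
  simp only [Submodule.mem_iInf, not_forall] at h1
  obtain ⟨A, hA, h1⟩ := h1
  refine ⟨A, hA, fun z hz => ?_⟩
  have hne : (localCenter N hT).map (algebraMap T A) ≠ ⊤ := by
    rw [Ne, Ideal.eq_top_iff_one]
    intro h
    have hle : (localCenter N hT).map (algebraMap T A) ≤
        (extendTo (Submodule.map (Algebra.linearMap T K) (localCenter N hT)) A).comap
          (Algebra.linearMap A K) := by
      rw [Ideal.map, Ideal.span_le]
      rintro _ ⟨t, ht, rfl⟩
      exact Submodule.subset_span ⟨t, ht, rfl⟩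
    exact h1 (hle h)
  obtain ⟨Q, hQ, hle⟩ := Ideal.exists_le_maximal _ hne
  have hNQ : ∀ n ∈ N.asIdeal, algebraMap T A (algebraMap D T n) ∈ Q := fun n hn =>
    hle (Ideal.mem_map_of_mem _ ((algebraMap_mem_localCenter_iff hT).2 hn))
  -- If `z` is not in `D_N`, then `nz = c` with `n ∈ N` and `c ∉ N`; thus `Q` contains both `N` and
  -- `c`, hence `1`.
  by_contra hzN
  have hz0 : z ≠ 0 := by rintro rfl; exact hzN (zero_mem _)
  obtain ⟨c, hc, n, hn⟩ := mem_locAt_iff.1 (inv_mem_locAt_of_notMem hD hzN)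
  have hnz : algebraMap D K n * z = algebraMap D K c := by
    rw [← hn, Algebra.smul_def, inv_mul_cancel_right₀ hz0]
  have hnN : n ∈ N.asIdeal := by
    by_contra hnN
    exact hzN (mem_locAt_iff.2 ⟨n, hnN, c, by rw [Algebra.smul_def, hnz]⟩)
  have hcQ : algebraMap T A (algebraMap D T c) ∈ Q := by
    have : algebraMap T A (algebraMap D T c) = algebraMap T A (algebraMap D T n) * ⟨z, hz⟩ :=
      Subtype.ext hnz.symm
    exact this ▸ Q.mul_mem_right _ (hNQ n hnN)
  obtain ⟨d, i, hi, hdi⟩ := N.isMaximal.exists_inv hc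
  refine hQ.ne_top (Q.eq_top_iff_one.2 ?_)
  have := Q.add_mem (Q.mul_mem_left (algebraMap T A (algebraMap D T d)) hcQ) (hNQ i hi)
  rwa [← map_mul, ← map_mul, ← map_add, ← map_add, hdi, map_one, map_one] at this

/-- If `D_M` is a Jaffard overring of `T`, then `M` is isolated among the maximal ideals `N`
with `T ⊆ D_N`. -/
theorem IsJaffardOverringOf.exists_notMem_dvd (hD : IsAlmostDedekind D)
    (hJ : IsJaffardOverringOf T (locAt K M)) {x : D} (hx : x ≠ 0) :
    ∃ b ∉ M.asIdeal, ∀ N ≠ M, T ≤ locAt K N → ∃ c ∉ N.asIdeal, x ∣ c * b := by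
  obtain ⟨S, hS, Θ, hΘ, hSΘ⟩ := hJ
  have hmemS : ∀ z, z ∈ S ↔ z ∈ locAt K M := fun z => by rw [← hS]; rfl
  have hxK : algebraMap D K x ≠ 0 := by rwa [Ne, FaithfulSMul.algebraMap_eq_zero_iff]
  have hT : ∀ t : T, algebraMap T K t ∈ locAt K M := fun t => (hmemS _).1 (S.algebraMap_mem t)
  have hST : (localCenter M fun s : S => (hmemS _).1 s.2).comap (algebraMap T S) =
      localCenter M hT := rfl
  have hmul : ∀ A ∈ Θ, A ≠ S →
      ∃ t ∉ localCenter M hT, ∃ a ∈ A, algebraMap T K t = algebraMap D K x * a := by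
    intro A hA hAS
    -- If `x ∈ M`, the center is nonzero, and independence from `S` keeps it from being contracted
    -- from `A`.
    by_cases hxM : x ∈ M.asIdeal
    · refine exists_notMem_localCenter_eq_mul hD hT (fun Q hQ => hx ?_) hx
      have hmem : (⟨localCenter M hT, inferInstance⟩ : PrimeSpectrum T) ∈
          sigmaSet A ∩ sigmaSet S :=
        ⟨⟨Q, PrimeSpectrum.ext hQ⟩, ⟨⟨localCenter M fun s : S => (hmemS _).1 s.2, inferInstance⟩,
            PrimeSpectrum.ext hST⟩⟩
      rw [hΘ.independent A hA S hSΘ hAS] at hmem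
      have hbot : localCenter M hT = ⊥ := hmem
      have := (algebraMap_mem_localCenter_iff hT).2 hxM
      rwa [hbot, Ideal.mem_bot, FaithfulSMul.algebraMap_eq_zero_iff] at this
    · exact ⟨algebraMap D T x, fun h => hxM ((algebraMap_mem_localCenter_iff hT).1 h), 1,
        one_mem _, (mul_one _).symm⟩
  choose! t ht a ha hta using hmul
  have hfin : {A ∈ Θ | ¬ (algebraMap D K x ∈ A ∧ (algebraMap D K x)⁻¹ ∈ A)}.Finite :=
    hΘ.locallyFinite _ hxK
  classical
  -- Local finiteness leaves finitely many `A ≠ S` in which `x` is not a unit; one product serves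
  -- them all.
  have hp : ∏ A ∈ hfin.toFinset.erase S, t A ∉ localCenter M hT := by
    rw [Ideal.IsPrime.prod_mem_iff]
    rintro ⟨A, hA, h⟩
    rw [Finset.mem_erase, Set.Finite.mem_toFinset] at hA
    exact ht A hA.2.1 hA.1 h
  set p := ∏ A ∈ hfin.toFinset.erase S, t A
  obtain ⟨c, hc, b, hb, hcb⟩ := exists_notMem_smul_eq_of_notMem_localCenter hT hp
  refine ⟨b, hb, fun N hN hTN => ?_⟩
  -- In a member `A ⊆ D_N`, either `x` is a unit or `t A`, a multiple of `x` in `A`, divides `p`; so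
  -- `x` divides `p` in `D_N`.
  obtain ⟨A, hA, hAN⟩ := hΘ.complete.exists_le_locAt hD (N := N) fun t => hTN t.2
  have hAS : A ≠ S := by
    rintro rfl
    exact hN (eq_of_locAt_le fun z hz => hAN z ((hmemS z).2 hz)).symm
  have hpx : (algebraMap D K x)⁻¹ * algebraMap T K p ∈ locAt K N := by
    by_cases hxA : algebraMap D K x ∈ A ∧ (algebraMap D K x)⁻¹ ∈ A
    · exact mul_mem (hAN _ hxA.2) (hTN p.2)
    · have hAF : A ∈ hfin.toFinset.erase S := by
        rw [Finset.mem_erase, Set.Finite.mem_toFinset]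
        exact ⟨hAS, hA, hxA⟩
      obtain ⟨q, hq⟩ := Finset.dvd_prod_of_mem t hAF
      have : p = t A * q := hq
      rw [this, map_mul, hta A hA hAS, mul_assoc, inv_mul_cancel_left₀ hxK]
      exact mul_mem (hAN _ (ha A hA hAS)) (hTN q.2)
  have hbx : (algebraMap D K x)⁻¹ * algebraMap D K b ∈ locAt K N := by
    rw [← hcb, mul_smul_comm]
    exact Subalgebra.smul_mem _ hpx c
  obtain ⟨d, hd, e, he⟩ := mem_locAt_iff.1 hbx
  refine ⟨d, hd, e, FaithfulSMul.algebraMap_injective D K ?_⟩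
  rw [map_mul, map_mul, ← he, Algebra.smul_def]
  field_simp

end JaffardIsolation

/-! ### Recursion equations for the derived family. -/

section DerivedFamily

variable {D : Type v} {K : Type u} [CommRing D] [Field K] [Algebra D K]

theorem derivedFamily_zero (Θ : Set (Subalgebra D K)) : derivedFamily Θ 0 = Θ :=
  Ordinal.limitRecOn_zero ..

theorem derivedFamily_add_one (Θ : Set (Subalgebra D K)) (α : Ordinal.{u}) :
    derivedFamily Θ (α + 1) = {S ∈ derivedFamily Θ α |
      ¬ IsJaffardOverringOf (sInf (derivedFamily Θ α)) S} :=
  Ordinal.limitRecOn_add_one ..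

theorem derivedFamily_limit (Θ : Set (Subalgebra D K)) {α : Ordinal.{u}}
    (hα : Order.IsSuccLimit α) :
    derivedFamily Θ α = {S | ∀ β < α, S ∈ derivedFamily Θ β} :=
  Ordinal.limitRecOn_limit _ _ _ _ hα

end DerivedFamily

/-! ### Semistar operations and stability. -/

section SemistarGeneralities

variable {D : Type v} {K : Type u} [CommRing D] [Field K] [Algebra D K]

theorem SemistarOperation.toFun_bot (s : SemistarOperation D K) : s.toFun ⊥ = ⊥ := by
  have h := s.smul 0 ⊥
  rw [zero_pointwise_smul, zero_pointwise_smul] at h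
  exact h.symm

theorem SemistarOperation.toFun_top (s : SemistarOperation D K) : s.toFun ⊤ = ⊤ :=
  top_le_iff.1 (s.le_toFun ⊤)

theorem pointwise_smul_ne_bot {x : K} (hx : x ≠ 0) {I : Submodule D K} (hI : I ≠ ⊥) :
    x • I ≠ ⊥ := by
  obtain ⟨y, hy, hy0⟩ := I.exists_mem_ne_zero_of_ne_bot hI
  exact (Submodule.ne_bot_iff _).2
    ⟨x * y, Submodule.smul_mem_pointwise_smul y x I hy, mul_ne_zero hx hy0⟩

/-- Any two nonzero elements of `K` have a common nonzero `D`-multiple. -/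
theorem inf_ne_bot_of_isFractionRing [Nontrivial D] [IsFractionRing D K] {I J : Submodule D K}
    (hI : I ≠ ⊥) (hJ : J ≠ ⊥) : I ⊓ J ≠ ⊥ := by
  obtain ⟨y, hy, hy0⟩ := I.exists_mem_ne_zero_of_ne_bot hI
  obtain ⟨z, hz, hz0⟩ := J.exists_mem_ne_zero_of_ne_bot hJ
  obtain ⟨a, b, hb, hab⟩ := IsFractionRing.div_surjective D (y / z)
  have hb0 : algebraMap D K b ≠ 0 := IsFractionRing.to_map_ne_zero_of_mem_nonZeroDivisors hb
  have heq : b • y = a • z := by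
    rw [Algebra.smul_def, Algebra.smul_def]
    field_simp at hab
    exact hab.symm
  refine (Submodule.ne_bot_iff _).2 ⟨b • y, ⟨I.smul_mem _ hy, heq ▸ J.smul_mem _ hz⟩, ?_⟩
  rw [Algebra.smul_def]
  exact mul_ne_zero hb0 hy0

/-- Conductors are computed inside a stable closure. -/
theorem SemistarOperation.IsStable.mem_toFun_iff_one_mem {s : SemistarOperation D K}
    (hs : s.IsStable) {x : K} (hx : x ≠ 0) {I J : Submodule D K} (h1 : (1 : K) ∈ J) :
    x ∈ s.toFun I ↔ 1 ∈ s.toFun (x⁻¹ • I ⊓ J) := by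
  rw [hs, Submodule.mem_inf, and_iff_left (s.le_toFun J h1), ← s.smul,
    mem_pointwise_smul_iff (inv_ne_zero hx), inv_inv, mul_one]

/-- The conductor of `x` into `I` lies in no maximal ideal, so it contains `1`. -/
theorem Submodule.mem_of_forall_exists_notMem_smul_mem {V : Type*} [AddCommGroup V] [Module D V]
    {I : Submodule D V} {x : V}
    (h : ∀ M : MaximalSpectrum D, ∃ c ∉ M.asIdeal, c • x ∈ I) : x ∈ I := by
  by_contra hx
  have hne : I.comap (LinearMap.toSpanSingleton D V x) ≠ ⊤ := fun htop => by
    have h1 : (1 : D) ∈ I.comap (LinearMap.toSpanSingleton D V x) := htop ▸ trivial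
    exact hx (by simpa using h1)
  obtain ⟨M, hM, hle⟩ := Ideal.exists_le_maximal _ hne
  obtain ⟨c, hc, hcx⟩ := h ⟨M, hM⟩
  exact hc (hle (by simpa using hcx))

end SemistarGeneralities

/-! ### Stable closures are determined locally. -/

section LocalToGlobal

variable {D : Type v} {K : Type u} [CommRing D] [IsDomain D] [Field K] [Algebra D K]
  [IsFractionRing D K]

/-- The maximal ideals that disappear in the derived sequence do not contain the closure of an
integral ideal whose localizations all have closures containing `1`. -/
theorem SemistarOperation.IsStable.exists_notMem_algebraMap_mem (hD : IsAlmostDedekind D)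
    {s : SemistarOperation D K} (hs : s.IsStable) (α : Ordinal.{u}) :
    ∀ M : MaximalSpectrum D, locAt K M ∉ derivedFamily (Set.range (locAt K)) α →
      ∀ J : Submodule D K, J ≠ ⊥ → J ≤ 1 →
        (∀ N, 1 ∈ s.toFun ((extendTo J (locAt K N)).restrictScalars D)) →
        ∃ b ∉ M.asIdeal, algebraMap D K b ∈ s.toFun J := by
  induction α using Ordinal.limitRecOn with
  | zero =>
    intro M hM
    rw [derivedFamily_zero] at hM
    exact absurd ⟨M, rfl⟩ hM
  | limit α hα ih =>
    intro M hM
    simp only [derivedFamily_limit _ hα, Set.mem_ofPred_eq, not_forall] at hM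
    obtain ⟨β, hβ, hM⟩ := hM
    exact ih β hβ M hM
  | add_one α ih =>
    intro M hM J hJ hJ1 hloc
    by_cases hMα : locAt K M ∉ derivedFamily (Set.range (locAt K)) α
    · exact ih M hMα J hJ hJ1 hloc
    rw [not_not] at hMα
    have hJaf : IsJaffardOverringOf
        (sInf (derivedFamily (Set.range (locAt K : MaximalSpectrum D → _)) α)) (locAt K M) := by
      by_contra h
      rw [derivedFamily_add_one] at hM
      exact hM ⟨hMα, h⟩
    obtain ⟨z, hz, hz0⟩ := J.exists_mem_ne_zero_of_ne_bot hJ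
    obtain ⟨x, rfl⟩ := Submodule.mem_one.1 (hJ1 hz)
    have hx : x ≠ 0 := by rintro rfl; exact hz0 (map_zero _)
    obtain ⟨b, hb, hbN⟩ := hJaf.exists_notMem_dvd hD hx
    have hb0 : algebraMap D K b ≠ 0 := algebraMap_ne_zero_of_notMem hb
    refine ⟨b, hb, (hs.mem_toFun_iff_one_mem hb0 (Submodule.one_le.1 le_rfl)).2 ?_⟩
    -- `Q` is the conductor `(J : b)`; the goal is now `1 ∈ s(Q)`.
    set Q : Submodule D K := (algebraMap D K b)⁻¹ • J ⊓ 1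
    have hmemQ : ∀ d : D, algebraMap D K d ∈ Q ↔ b • algebraMap D K d ∈ J := fun d => by
      rw [Submodule.mem_inf, and_iff_left (Submodule.mem_one.2 ⟨d, rfl⟩),
        mem_pointwise_smul_iff (inv_ne_zero hb0), inv_inv, Algebra.smul_def]
    have hJQ : J ≤ Q := fun y hy => by
      obtain ⟨d, rfl⟩ := Submodule.mem_one.1 (hJ1 hy)
      exact (hmemQ d).2 (J.smul_mem b hy)
    have hlocQ : ∀ N, 1 ∈ s.toFun ((extendTo Q (locAt K N)).restrictScalars D) := fun N =>
      s.mono _ _ (extendTo_mono hJQ _) (hloc N)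
    have hQ : Q ≠ ⊥ := fun h => hJ (le_bot_iff.1 (h ▸ hJQ))
    -- Checked at each `N`: clear a denominator if `N = M`; use isolation, `cb ∈ xD ⊆ J`, if `N`
    -- survives; otherwise apply induction to `Q`.
    have hle : (extendTo Q (locAt K M)).restrictScalars D ⊓ 1 ≤ s.toFun Q := by
      rintro y ⟨hyM, hy1⟩
      obtain ⟨d, rfl⟩ := Submodule.mem_one.1 hy1
      refine Submodule.mem_of_forall_exists_notMem_smul_mem fun N => ?_
      by_cases hNM : N = M
      · subst hNM
        obtain ⟨c, hc, h⟩ := mem_extendTo_locAt.1 hyM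
        exact ⟨c, hc, s.le_toFun Q h⟩
      by_cases hNα : locAt K N ∈ derivedFamily (Set.range (locAt K)) α
      · obtain ⟨c, hc, a, ha⟩ := hbN N hNM (sInf_le hNα)
        have hcQ : algebraMap D K c ∈ Q := by
          rw [hmemQ, Algebra.smul_def, ← map_mul, mul_comm, ha, mul_comm, map_mul,
            ← Algebra.smul_def]
          exact J.smul_mem a hz
        refine ⟨c, hc, s.le_toFun Q ?_⟩
        rw [Algebra.smul_def, mul_comm, ← Algebra.smul_def]
        exact Q.smul_mem d hcQ
      · obtain ⟨c, hc, h⟩ := ih N hNα Q hQ inf_le_right hlocQ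
        refine ⟨c, hc, ?_⟩
        rw [Algebra.smul_def, mul_comm, ← Algebra.smul_def]
        exact Submodule.smul_mem _ d h
    -- By stability `s(Q D_M ∩ D) = s(Q D_M) ∩ s(D)`, which contains `1`.
    rw [← s.idem Q]
    refine s.mono _ _ hle ?_
    rw [hs]
    exact ⟨hlocQ M, s.le_toFun 1 (Submodule.one_le.1 le_rfl)⟩

/-- Where the derived ring is `K`, every remaining member equals `K`; but no `D_M` is a field. -/
theorem exists_derivedFamily_eq_empty (hD : IsAlmostDedekind D) (h : IsUltimatelySharp D K) :
    ∃ α, ∀ M, locAt K M ∉ derivedFamily (Set.range (locAt K : MaximalSpectrum D → _)) α := by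
  refine ⟨jaffardDegree (Set.range (locAt K : MaximalSpectrum D → _)), fun M hM => ?_⟩
  have htop : locAt K M = ⊤ := top_le_iff.1 (h.ge.trans (sInf_le hM))
  have := isDiscreteValuationRing_locAt (K := K) hD M
  refine IsDiscreteValuationRing.not_isField (locAt K M) ?_
  refine MulEquiv.isField (Field.toIsField K)
    ((Subalgebra.equivOfEq _ _ htop).trans Subalgebra.topEquiv).toMulEquiv

/-- Stable operations on an ultimately sharp almost Dedekind domain are determined locally. -/
theorem SemistarOperation.IsStable.toFun_eq_iInf (hD : IsAlmostDedekind D)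
    (h : IsUltimatelySharp D K) {s : SemistarOperation D K} (hs : s.IsStable)
    (I : Submodule D K) :
    s.toFun I = ⨅ M, s.toFun ((extendTo I (locAt K M)).restrictScalars D) := by
  refine le_antisymm (le_iInf fun M => s.mono _ _ (le_extendTo I _)) fun x hx => ?_
  rw [Submodule.mem_iInf] at hx
  by_cases hx0 : x = 0
  · exact hx0 ▸ Submodule.zero_mem _
  obtain ⟨α, hα⟩ := exists_derivedFamily_eq_empty hD h
  rw [hs.mem_toFun_iff_one_mem hx0 (Submodule.one_le.1 le_rfl)]
  by_cases hI : I = ⊥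
  · subst hI
    obtain ⟨M⟩ : Nonempty (MaximalSpectrum D) := inferInstance
    have := hx M
    rw [extendTo_bot, Submodule.restrictScalars_bot, s.toFun_bot] at this
    exact absurd this hx0
  -- The reduction from `x` to `1` is repeated at each `N`, extension to `D_N` commuting with
  -- intersections and with multiplication by `x⁻¹`.
  have hloc : ∀ N, 1 ∈ s.toFun ((extendTo (x⁻¹ • I ⊓ 1) (locAt K N)).restrictScalars D) := by
    intro N
    refine s.mono _ _ (fun z hz => ?_) ((hs.mem_toFun_iff_one_mem hx0
      (le_extendTo 1 (locAt K N) (Submodule.one_le.1 le_rfl))).1 (hx N))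
    rw [Submodule.mem_inf, mem_pointwise_smul_iff (inv_ne_zero hx0),
      Submodule.restrictScalars_mem, Submodule.restrictScalars_mem] at hz
    rw [Submodule.restrictScalars_mem, extendTo_locAt_inf, Submodule.mem_inf,
      extendTo_locAt_smul (inv_ne_zero hx0), mem_pointwise_smul_iff (inv_ne_zero hx0)]
    exact hz
  have hne : x⁻¹ • I ⊓ 1 ≠ ⊥ :=
    inf_ne_bot_of_isFractionRing (pointwise_smul_ne_bot (inv_ne_zero hx0) hI) one_ne_zero
  refine Submodule.mem_of_forall_exists_notMem_smul_mem fun M => ?_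
  obtain ⟨b, hb, h⟩ := hs.exists_notMem_algebraMap_mem hD α M (hα M) _ hne inf_le_right hloc
  exact ⟨b, hb, by rwa [Algebra.smul_def, mul_one]⟩

end LocalToGlobal

/-! ### The identity and trivial operations. -/

section LocalOperations

variable {D : Type v} {K : Type u} [CommRing D] [Field K] [Algebra D K]

variable (D K) in
/-- The identity operation. -/
noncomputable def StableSemistar.identity : StableSemistar D K :=
  ⟨{  toFun I := I
      le_toFun _ := le_rfl
      mono _ _ h := h
      idem _ := rfl
      smul _ _ := rfl }, fun _ _ => rfl⟩

theorem pointwise_smul_top {x : K} (hx : x ≠ 0) : x • (⊤ : Submodule D K) = ⊤ := by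
  rw [eq_top_iff]
  exact fun z _ => (mem_pointwise_smul_iff hx).2 trivial

open scoped Classical in
variable (D K) in
/-- The operation sending every nonzero submodule to `K`. -/
noncomputable def StableSemistar.trivial [Nontrivial D] [IsFractionRing D K] : StableSemistar D K :=
  ⟨{  toFun I := if I = ⊥ then ⊥ else ⊤
      le_toFun I := by split_ifs with h <;> simp [h]
      mono I J h := by
        by_cases hJ : J = ⊥
        · subst hJ
          simp [le_bot_iff.1 h]
        · simp [hJ]
      idem I := by by_cases hI : I = ⊥ <;> simp [hI]
      smul x I := by
        by_cases hx : x = 0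
        · simp [hx]
        by_cases hI : I = ⊥
        · have : x • (⊥ : Submodule D K) = ⊥ := Submodule.smul_bot' x
          simp [hI, this]
        · simp [hI, pointwise_smul_ne_bot hx hI, pointwise_smul_top hx] }, fun I J => by
    by_cases hI : I = ⊥
    · simp [hI]
    by_cases hJ : J = ⊥
    · simp [hJ]
    simp [hI, hJ, inf_ne_bot_of_isFractionRing hI hJ]⟩

theorem StableSemistar.identity_toFun (I : Submodule D K) : (identity D K).1.toFun I = I := rfl

theorem StableSemistar.trivial_toFun [Nontrivial D] [IsFractionRing D K] {I : Submodule D K} (hI : I ≠ ⊥) :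
    (StableSemistar.trivial D K).1.toFun I = ⊤ :=
  if_neg hI

end LocalOperations

/-! ### Operations on each `D_M`, gluing, and the bijections. -/

section MainResult

variable {D : Type v} {K : Type u} [CommRing D] [IsDomain D] [Field K] [Algebra D K]
  [IsFractionRing D K]

theorem locAt_identity_ne_trivial (hD : IsAlmostDedekind D) (M : MaximalSpectrum D) :
    StableSemistar.identity (locAt K M) K ≠ StableSemistar.trivial (locAt K M) K := by
  intro h
  have hone : (1 : Submodule (locAt K M) K) ≠ ⊥ := one_ne_zero
  have h1 : (1 : Submodule (locAt K M) K) = ⊤ := by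
    rw [← StableSemistar.trivial_toFun hone, ← h, StableSemistar.identity_toFun]
  have := isDiscreteValuationRing_locAt (K := K) hD M
  refine IsDiscreteValuationRing.not_isField (locAt K M) ?_
  refine MulEquiv.isField (Field.toIsField K) (RingEquiv.ofBijective (algebraMap (locAt K M) K)
    ⟨FaithfulSMul.algebraMap_injective _ _, fun z => ?_⟩).toMulEquiv
  exact Submodule.mem_one.1 (h1 ▸ Submodule.mem_top : z ∈ (1 : Submodule (locAt K M) K))

/-- If some `I` grows, scaling shows that the closure of `D_M` contains `ϖ⁻¹`; idempotence then
makes it stable under `ϖ⁻¹`, so it is `K`. -/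
theorem locAt_eq_identity_or_eq_trivial (hD : IsAlmostDedekind D) (M : MaximalSpectrum D)
    (s : StableSemistar (locAt K M) K) :
    s = StableSemistar.identity (locAt K M) K ∨ s = StableSemistar.trivial (locAt K M) K := by
  by_cases hid : ∀ I, s.1.toFun I = I
  · exact .inl (Subtype.ext (SemistarOperation.ext (funext hid)))
  right
  push Not at hid
  obtain ⟨I, hI⟩ := hid
  obtain ⟨y, hy, hyI⟩ := SetLike.not_le_iff_exists.1 fun h => hI (le_antisymm h (s.1.le_toFun I))
  have hI0 : I ≠ ⊥ := by
    rintro rfl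
    rw [s.1.toFun_bot] at hy
    exact hyI hy
  obtain ⟨w, hw, hw0⟩ := I.exists_mem_ne_zero_of_ne_bot hI0
  have hy0 : y ≠ 0 := by rintro rfl; exact hyI I.zero_mem
  have := isDiscreteValuationRing_locAt (K := K) hD M
  obtain ⟨ϖ, hϖ⟩ := IsDiscreteValuationRing.exists_irreducible (locAt K M)
  have hϖ0 : (ϖ : K) ≠ 0 := fun h => hϖ.ne_zero (Subtype.ext h)
  have hϖinv : (ϖ : K)⁻¹ ∉ locAt K M := fun h => hϖ.not_isUnit
    (IsUnit.of_mul_eq_one ⟨_, h⟩ (Subtype.ext (mul_inv_cancel₀ hϖ0)))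
  -- Since `y ∉ I`, every element of `I` has valuation strictly above that of `y`; the factor `ϖ`
  -- records the strictness.
  have hle : I ≤ (y * ϖ) • 1 := by
    intro z hz
    rw [mem_pointwise_smul_iff (mul_ne_zero hy0 hϖ0), Submodule.mem_one]
    by_cases hz0 : z = 0
    · exact ⟨0, by simp [hz0]⟩
    have hyz : y * z⁻¹ ∉ locAt K M := fun h => hyI (by
      have := I.smul_mem ⟨_, h⟩ hz
      rwa [Subalgebra.smul_def, smul_eq_mul, inv_mul_cancel_right₀ hz0] at this)
    have hzy : z * y⁻¹ ∈ locAt K M := by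
      have := inv_mem_locAt_of_notMem hD hyz
      rwa [mul_inv, inv_inv, mul_comm] at this
    have hdvd : ϖ ∣ ⟨_, hzy⟩ := by
      rw [← Ideal.mem_span_singleton, ← hϖ.maximalIdeal_eq, IsLocalRing.mem_maximalIdeal,
        mem_nonunits_iff]
      intro h
      obtain ⟨b, hb⟩ := h.exists_right_inv
      have hb' : z * y⁻¹ * (b : K) = 1 := congrArg Subtype.val hb
      refine hyz ?_
      have : y * z⁻¹ = b := by
        rw [eq_inv_of_mul_eq_one_right hb', mul_inv, inv_inv, mul_comm]
      exact this ▸ b.2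
    obtain ⟨a, ha⟩ := hdvd
    have ha' : z * y⁻¹ = (ϖ : K) * a := congrArg Subtype.val ha
    refine ⟨a, ?_⟩
    change (a : K) = _
    rw [mul_inv, mul_comm y⁻¹, mul_assoc, mul_comm y⁻¹, ha', inv_mul_cancel_left₀ hϖ0]
  have hone : s.1.toFun 1 = ⊤ := by
    refine eq_top_of_mul_mem hD hϖinv
      (fun h => one_ne_zero (le_bot_iff.1 (h ▸ s.1.le_toFun 1))) fun a ha => ?_
    have hyϖ := s.1.mono _ _ hle hy
    rw [← s.1.smul, mem_pointwise_smul_iff (mul_ne_zero hy0 hϖ0), mul_inv, mul_comm y⁻¹,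
      mul_assoc, inv_mul_cancel₀ hy0, mul_one] at hyϖ
    have hle' : (ϖ : K)⁻¹ • (1 : Submodule (locAt K M) K) ≤ s.1.toFun 1 := by
      rintro _ ⟨c, hc, rfl⟩
      obtain ⟨d, rfl⟩ := Submodule.mem_one.1 hc
      have := (s.1.toFun 1).smul_mem d hyϖ
      rwa [Subalgebra.smul_def, smul_eq_mul, mul_comm] at this
    have := s.1.mono _ _ hle'
    rw [s.1.idem, ← s.1.smul] at this
    exact this (Submodule.smul_mem_pointwise_smul a _ _ ha)
  refine Subtype.ext (SemistarOperation.ext (funext fun J => ?_))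
  by_cases hJ : J = ⊥
  · rw [hJ, s.1.toFun_bot, SemistarOperation.toFun_bot]
  rw [StableSemistar.trivial_toFun hJ]
  obtain ⟨z, hz, hz0⟩ := J.exists_mem_ne_zero_of_ne_bot hJ
  -- Every nonzero `J` contains a scaled copy of `D_M`, whose closure is already `K`.
  have hzJ : z • (1 : Submodule (locAt K M) K) ≤ J := by
    rintro _ ⟨c, hc, rfl⟩
    obtain ⟨d, rfl⟩ := Submodule.mem_one.1 hc
    have := J.smul_mem d hz
    rwa [Subalgebra.smul_def, smul_eq_mul, mul_comm] at this
  rw [eq_top_iff, ← pointwise_smul_top hz0, ← hone, s.1.smul]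
  exact s.1.mono _ _ hzJ

/-- The operation `I ↦ ⋂ (I D_M)^{f M}` glued from operations `f M` on the localizations. -/
noncomputable def StableSemistar.glue (f : ∀ M : MaximalSpectrum D, StableSemistar (locAt K M) K) :
    StableSemistar D K :=
  ⟨{  toFun I := ⨅ M, ((f M).1.toFun (extendTo I (locAt K M))).restrictScalars D
      le_toFun I := le_iInf fun M => (le_extendTo I _).trans ((f M).1.le_toFun _)
      mono I J h := iInf_mono fun M => (f M).1.mono _ _ (extendTo_mono h _)
      idem I := by
        refine le_antisymm (iInf_mono fun M => ?_)
          (le_iInf fun M => (le_trans ?_ (le_extendTo _ _)).trans ((f M).1.le_toFun _))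
        · have : extendTo (⨅ M, ((f M).1.toFun (extendTo I (locAt K M))).restrictScalars D)
              (locAt K M) ≤ (f M).1.toFun (extendTo I (locAt K M)) :=
            Submodule.span_le.2 (iInf_le (fun M =>
              ((f M).1.toFun (extendTo I (locAt K M))).restrictScalars D) M)
          exact ((f M).1.mono _ _ this).trans ((f M).1.idem _).le
        · exact le_rfl
      smul x I := by
        by_cases hx : x = 0
        · subst hx
          -- A maximal ideal must exist here: an empty intersection would be `K`, not zero.
          obtain ⟨M⟩ : Nonempty (MaximalSpectrum D) := inferInstance
          rw [zero_pointwise_smul, zero_pointwise_smul, eq_comm, eq_bot_iff]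
          refine (iInf_le _ M).trans ?_
          rw [extendTo_bot, (f M).1.toFun_bot]
          rfl
        · ext z
          simp only [mem_pointwise_smul_iff hx, Submodule.mem_iInf,
            Submodule.restrictScalars_mem, extendTo_locAt_smul hx, ← (f _).1.smul] }, fun I J => by
    ext z
    simp only [Submodule.mem_inf, Submodule.mem_iInf, Submodule.restrictScalars_mem,
      extendTo_locAt_inf, (f _).2 _ _, forall_and]⟩

theorem StableSemistar.glue_toFun (f : ∀ M : MaximalSpectrum D, StableSemistar (locAt K M) K)
    (I : Submodule D K) : (glue f).1.toFun I =
      ⨅ M, ((f M).1.toFun (extendTo I (locAt K M))).restrictScalars D :=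
  rfl

theorem StableSemistar.restrict_glue (hD : IsAlmostDedekind D)
    (f : ∀ M : MaximalSpectrum D, StableSemistar (locAt K M) K) (N : MaximalSpectrum D) :
    (glue f).restrict (locAt K N) = f N := by
  refine Subtype.ext (SemistarOperation.ext (funext fun I => ?_))
  by_cases hI : I = ⊥
  · rw [hI, SemistarOperation.toFun_bot, SemistarOperation.toFun_bot]
  ext z
  change z ∈ (glue f).1.toFun (I.restrictScalars D) ↔ _
  simp only [glue_toFun, Submodule.mem_iInf, Submodule.restrictScalars_mem]
  constructor
  · intro h
    have := h N
    rwa [extendTo_restrictScalars] at this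
  · intro h M
    by_cases hMN : N = M
    · subst hMN
      rwa [extendTo_restrictScalars]
    -- The factors at the other maximal ideals are all `K` and impose no condition.
    · rw [extendTo_locAt_eq_top hD hMN hI, SemistarOperation.toFun_top]
      exact Submodule.mem_top

theorem StableSemistar.glue_restrict (hD : IsAlmostDedekind D) (h : IsUltimatelySharp D K)
    (s : StableSemistar D K) :
    glue (fun M : MaximalSpectrum D => s.restrict (locAt K M)) = s := by
  refine Subtype.ext (SemistarOperation.ext (funext fun I => ?_))
  rw [s.2.toFun_eq_iInf hD h I]
  rfl

/-- Restriction to the localizations, with inverse given by gluing. -/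
noncomputable def StableSemistar.restrictOrderIso (hD : IsAlmostDedekind D) (h : IsUltimatelySharp D K) :
    StableSemistar D K ≃o (∀ M : MaximalSpectrum D, StableSemistar (locAt K M) K) where
  toFun s M := s.restrict (locAt K M)
  invFun := glue
  left_inv := glue_restrict hD h
  right_inv f := funext (restrict_glue hD f)
  map_rel_iff' {s t} := by
    constructor
    · intro hst I
      rw [s.2.toFun_eq_iInf hD h I, t.2.toFun_eq_iInf hD h I]
      exact iInf_mono fun M => hst M (extendTo I (locAt K M))
    · exact fun hst M I => hst (I.restrictScalars D)

open scoped Classical in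
/-- Families of stable operations on the localizations correspond to sets of maximal ideals. -/
noncomputable def StableSemistar.localEquivSet (hD : IsAlmostDedekind D) :
    (∀ M : MaximalSpectrum D, StableSemistar (locAt K M) K) ≃ Set (MaximalSpectrum D) where
  toFun f := {M | ∀ I, (f M).1.toFun I = I}
  invFun S M := if M ∈ S then identity (locAt K M) K else StableSemistar.trivial (locAt K M) K
  left_inv f := by
    funext M
    change (if ∀ I, (f M).1.toFun I = I then _ else _) = _
    split_ifs with hM
    · exact (Subtype.ext (SemistarOperation.ext (funext hM))).symm
    · refine ((locAt_eq_identity_or_eq_trivial hD M (f M)).resolve_left fun h => hM ?_).symm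
      rw [h]
      exact identity_toFun
  right_inv S := by
    ext M
    change (∀ I, (if M ∈ S then _ else _ : StableSemistar (locAt K M) K).1.toFun I = I) ↔ _
    split_ifs with hM
    · exact iff_of_true identity_toFun hM
    · exact iff_of_false (fun h => locAt_identity_ne_trivial hD M
        (Subtype.ext (SemistarOperation.ext (funext h))).symm) hM

theorem StableSemistar.glue_localEquivSet_symm (hD : IsAlmostDedekind D)
    (S : Set (MaximalSpectrum D)) {I : Submodule D K} (hI : I ≠ ⊥) :
    (glue ((localEquivSet (K := K) hD).symm S)).1.toFun I =
      ⨅ M ∈ S, (extendTo I (locAt K M)).restrictScalars D := by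
  classical
  rw [glue_toFun]
  refine iInf_congr fun M => ?_
  change ((if M ∈ S then _ else _ : StableSemistar (locAt K M) K).1.toFun _).restrictScalars D = _
  by_cases hM : M ∈ S
  · rw [if_pos hM, iInf_pos hM, identity_toFun]
  · have hne : extendTo I (locAt K M) ≠ ⊥ := fun h => hI <| by
      rw [eq_bot_iff]
      exact fun y hy => (h ▸ le_extendTo I (locAt K M) hy : y ∈ (⊥ : Submodule (locAt K M) K))
    rw [if_neg hM, iInf_neg hM, trivial_toFun hne, Submodule.restrictScalars_top]

end MainResult

theorem mainTheorem7 (D : Type v) (K : Type u) [CommRing D] [IsDomain D] [Field K]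
    [Algebra D K] [IsFractionRing D K]
    (hD : IsAlmostDedekind D) (hsharp : IsUltimatelySharp D K) :
    -- restriction is an order isomorphism of `Stab(D)` onto the product of the `Stab(D_M)`
    (∃ e : StableSemistar D K ≃o (∀ M : MaximalSpectrum D, StableSemistar (locAt K M) K),
      (∀ s M, e s M = StableSemistar.restrict s (locAt K M)) ∧
      (∀ f I, (e.symm f).1.toFun I =
        ⨅ M, ((f M).1.toFun (extendTo I (locAt K M))).restrictScalars D)) ∧
    -- every `D_M` has exactly two stable operations
    (∀ M : MaximalSpectrum D, ∃ s₀ s₁ : StableSemistar (locAt K M) K, s₀ ≠ s₁ ∧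
      (∀ I, s₀.1.toFun I = I) ∧ (∀ I, I ≠ ⊥ → s₁.1.toFun I = ⊤) ∧
      ∀ s, s = s₀ ∨ s = s₁) ∧
    -- the resulting bijection of `Stab(D)` with the power set of `Max(D)`
    (∃ b : StableSemistar D K ≃ Set (MaximalSpectrum D),
      (∀ s, b s = {M | ∀ I, (StableSemistar.restrict s (locAt K M)).1.toFun I = I}) ∧
      (∀ S I, I ≠ ⊥ → (b.symm S).1.toFun I =
        ⨅ M ∈ S, (extendTo I (locAt K M)).restrictScalars D)) :=
  ⟨⟨StableSemistar.restrictOrderIso hD hsharp, fun _ _ => rfl, fun _ _ => rfl⟩,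
    fun M => ⟨StableSemistar.identity _ K, StableSemistar.trivial _ K,
      locAt_identity_ne_trivial hD M, StableSemistar.identity_toFun,
      fun _ hI => StableSemistar.trivial_toFun hI, locAt_eq_identity_or_eq_trivial hD M⟩,
    ⟨(StableSemistar.restrictOrderIso hD hsharp).toEquiv.trans
      (StableSemistar.localEquivSet hD), fun _ => rfl,
      fun S _ hI => StableSemistar.glue_localEquivSet_symm hD S hI⟩⟩
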